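/- Let $X$ be a finite mixed graph of order $n$ with vertices $v_1,\dots,v_n$: there are no loops, and any two distinct vertices $v_i,v_j$ are joined by at most one of an un-oriented edge ($i\sim j$), an oriented edge from $v_i$ to $v_j$ ($i\to j$), or an oriented edge from $v_j$ to $v_i$ ($j\to i$). Let $d_i$ be the degree of $v_i$ in the underlying un-oriented graph, and let $\omega=\frac{1+\mathbf i\sqrt3}{2}$. The Hermitian Randić matrix of the second kind $R^{\omega}(X)=(R^{\omega}_{ij})\in\mathbb C^{n\times n}$ is defined by $$R^{\omega}_{ij}=\begin{cases}\frac{1}{\sqrt{d_id_j}} & i\sim j,\\[2pt] \frac{\omega}{\sqrt{d_id_j}} & i\to j,\\[2pt] \frac{\overline{\omega}}{\sqrt{d_id_j}} & j\to i,\\[2pt] 0&\text{otherwise.}\end{cases}$$ A sub-graph of $X$ is spanning if it contains all vertices of $X$, and elementary if each of its connected components is either a single edge (with its two ends) or a cycle of length at least $3$; walks, cycles and components are those of the underlying un-oriented graph. For a sub-graph $Y$ of $X$ put $Q(Y)=\prod_{v_i\in V(Y)}\frac1{d_i}$, where $d_i$ is the degree in $X$. The value of a cycle $v_{i_1}v_{i_2}\cdots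 v_{i_k}v_{i_1}$ is $R^{\omega}_{i_1i_2}R^{\omega}_{i_2i_3}\cdots R^{\omega}_{i_ki_1}$; reversing the direction replaces it by its complex conjugate. A cycle $C$ is positive (negative) if its value is a positive (negative) real number, and semi-negative if its value is $-\omega Q(C)$ or $-\overline{\omega}Q(C)$. For an elementary sub-graph $X'$ let $l_p(X'),l_n(X'),l_{sn}(X')$ be the numbers of positive, negative and semi-negative cycles in $X'$, and let $r(X')$ be the number of vertices of $X'$ minus the number of connected components of $X'$. Then $$\det R^{\omega}(X)=\sum_{X'}(-1)^{r(X')+l_n(X')+l_{sn}(X')}\,2^{\,l_n(X')+l_p(X')}\,Q(X'),$$ where the sum is over all spanning elementary sub-graphs $X'$ of $X$ (so $r(X')=n-c(X')$, where $c(X')$ is the number of components of $X'$). -/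

import Mathlib

/-- A (simple) mixed graph on the vertex set `V`: every pair of distinct vertices is joined by at
most one of an un-oriented edge (`Und u v`), an oriented edge from `u` to `v` (`Arc u v`) and an
oriented edge from `v` to `u` (`Arc v u`); there are no loops. -/
structure MixedGraph (V : Type*) where
  /-- `Und u v`: there is an un-oriented edge between `u` and `v`. -/
  Und : V → V → Prop
  /-- `Arc u v`: there is an oriented edge from `u` to `v`. -/
  Arc : V → V → Prop
  und_symm : ∀ u v, Und u v → Und v u
  und_irrefl : ∀ u, ¬ Und u u
  arc_asymm : ∀ u v, Arc u v → ¬ Arc v u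
  und_not_arc : ∀ u v, Und u v → ¬ Arc u v

namespace MixedGraph

variable {V : Type*}

/-- The underlying graph of a mixed graph: forget all orientations. -/
def underlying (X : MixedGraph V) : SimpleGraph V where
  Adj u v := X.Und u v ∨ X.Arc u v ∨ X.Arc v u
  symm := ⟨fun u v h => by
    rcases h with h | h | h
    · exact Or.inl (X.und_symm u v h)
    · exact Or.inr (Or.inr h)
    · exact Or.inr (Or.inl h)⟩
  loopless := ⟨fun u h => by
    rcases h with h | h | h
    · exact X.und_irrefl u h
    · exact X.arc_asymm u u h h
    · exact X.arc_asymm u u h h⟩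

/-- A sub-graph of a mixed graph is a choice of vertices and edges; each chosen edge keeps the
orientation (or the absence of one) that it has in `X`.  It is therefore the same thing as a
sub-graph of the underlying graph. -/
abbrev Sub (X : MixedGraph V) : Type _ := X.underlying.Subgraph

/-- The primitive sixth root of unity `ω = (1 + i√3) / 2`. -/
noncomputable def omega : ℂ := (1 + Complex.I * (Real.sqrt 3 : ℂ)) / 2

/-- The degree of a vertex of `X`, i.e. its degree in the underlying graph. -/
noncomputable def degree (X : MixedGraph V) (v : V) : ℕ := (X.underlying.neighborSet v).ncard

open Classical in
/-- The Hermitian adjacency matrix of the second kind `H^ω(X)`. -/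
noncomputable def hermitianAdj (X : MixedGraph V) : Matrix V V ℂ :=
  Matrix.of fun u v =>
    if X.Und u v then 1
    else if X.Arc u v then omega
    else if X.Arc v u then (starRingEnd ℂ) omega
    else 0

/-- The Hermitian Randić matrix of the second kind `R^ω(X) = D^{-1/2} H^ω(X) D^{-1/2}`, given
entrywise: the entry at `(u, v)` is `h_{uv} / √(d_u d_v)`.  (If `u` or `v` is isolated, then
`h_{uv} = 0` and so the entry is `0`.) -/
noncomputable def randic (X : MixedGraph V) : Matrix V V ℂ :=
  Matrix.of fun u v =>
    X.hermitianAdj u v / (Real.sqrt ((X.degree u : ℝ) * (X.degree v : ℝ)) : ℂ)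

/-- The value of a walk `v₁ v₂ ⋯ v_ℓ`: the product `R_{v₁v₂} R_{v₂v₃} ⋯ R_{v_{ℓ-1}v_ℓ}`. -/
noncomputable def walkValue (X : MixedGraph V) {u v : V} (w : X.underlying.Walk u v) : ℂ :=
  (w.darts.map fun d => X.randic d.fst d.snd).prod

/-- `Q(Y) = ∏_{v ∈ V(Y)} 1 / d_v`, with the degrees taken in `X`. -/
noncomputable def Q (X : MixedGraph V) (Y : X.Sub) : ℝ :=
  ∏ᶠ v ∈ Y.verts, 1 / (X.degree v : ℝ)

/-- The closed walk `w` runs once around the cycle `C`. -/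
def Traverses (X : MixedGraph V) (C : X.Sub) {u : V} (w : X.underlying.Walk u u) : Prop :=
  w.IsCycle ∧ w.toSubgraph = C

/-- `C` is a cycle of `X` (of length at least 3, as the graph is simple). -/
def IsCycleSub (X : MixedGraph V) (C : X.Sub) : Prop :=
  ∃ (u : V) (w : X.underlying.Walk u u), X.Traverses C w

/-- `K` consists of a single edge together with its two ends. -/
def IsEdgeSub (X : MixedGraph V) (K : X.Sub) : Prop :=
  ∃ (u v : V) (h : X.underlying.Adj u v), K = X.underlying.subgraphOfAdj h

/-- The connected component `c` of the sub-graph `Y`, as a sub-graph of `X`. -/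
def componentSub (X : MixedGraph V) (Y : X.Sub) (c : Y.coe.ConnectedComponent) : X.Sub :=
  Y.induce (Subtype.val '' c.supp)

/-- `Y` is elementary: each of its components is an edge or a cycle. -/
def IsElementary (X : MixedGraph V) (Y : X.Sub) : Prop :=
  ∀ c : Y.coe.ConnectedComponent,
    X.IsEdgeSub (X.componentSub Y c) ∨ X.IsCycleSub (X.componentSub Y c)

/-- A cycle is positive if its value is a positive real number.  (Reversing the direction
conjugates the value, and the starting vertex is irrelevant, so the choice of the traversing walk
does not matter; likewise below.) -/
def IsPositiveCycle (X : MixedGraph V) (C : X.Sub) : Prop :=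
  ∃ (u : V) (w : X.underlying.Walk u u), X.Traverses C w ∧
    ∃ r : ℝ, 0 < r ∧ X.walkValue w = (r : ℂ)

/-- A cycle is negative if its value is a negative real number. -/
def IsNegativeCycle (X : MixedGraph V) (C : X.Sub) : Prop :=
  ∃ (u : V) (w : X.underlying.Walk u u), X.Traverses C w ∧
    ∃ r : ℝ, r < 0 ∧ X.walkValue w = (r : ℂ)

/-- A cycle `C` is semi-negative if its value is `-ω Q(C)` or `-ω̄ Q(C)`. -/
def IsSemiNegativeCycle (X : MixedGraph V) (C : X.Sub) : Prop :=
  ∃ (u : V) (w : X.underlying.Walk u u), X.Traverses C w ∧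
    (X.walkValue w = -omega * (X.Q C : ℂ) ∨
      X.walkValue w = -(starRingEnd ℂ) omega * (X.Q C : ℂ))

/-- `l_p(Y)`, the number of positive cycles in `Y`. -/
noncomputable def lp (X : MixedGraph V) (Y : X.Sub) : ℕ :=
  {C : X.Sub | C ≤ Y ∧ X.IsPositiveCycle C}.ncard

/-- `l_n(Y)`, the number of negative cycles in `Y`. -/
noncomputable def ln (X : MixedGraph V) (Y : X.Sub) : ℕ :=
  {C : X.Sub | C ≤ Y ∧ X.IsNegativeCycle C}.ncard

/-- `l_sn(Y)`, the number of semi-negative cycles in `Y`. -/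
noncomputable def lsn (X : MixedGraph V) (Y : X.Sub) : ℕ :=
  {C : X.Sub | C ≤ Y ∧ X.IsSemiNegativeCycle C}.ncard

/-- `r(Y)`: the number of vertices of `Y` minus the number `c(Y)` of its components.  (A finite
graph has at least as many vertices as components, so the subtraction does not truncate.) -/
noncomputable def rank (X : MixedGraph V) (Y : X.Sub) : ℕ :=
  Y.verts.ncard - Nat.card Y.coe.ConnectedComponent

end MixedGraph

/-! Expand the determinant over permutations. A permutation `τ` contributes only if every `v` is
adjacent to `τ v`; the edges `{v, τ v}` then form a spanning elementary sub-graph, whose edge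
components are the 2-cycles of `τ` and whose cycles are its longer cycles. Group the permutations by
the sub-graph `Y` they trace (`Compat τ Y`).

Every spanning elementary `Y` is traced by some `σ` (`exists_compat`), and the others follow `σ` or
`σ⁻¹` independently on each component. The orbits are the components of `Y`, so all have sign `(-1)
^ rank Y` (`Compat.sign_eq`), and the sum over them is a product over components
(`Compat.sum_prod`).

An edge component contributes its `Q`. A cycle `C` contributes its two directions, `z + conj z` with
`z = x * Q C` and `x ^ 6 = 1`. Here `2 Re x` is `2`, `-2`, `-1` or `1` according as `C` is positive,
negative, semi-negative or none of these (`add_conj_eq`), which is the stated weight. -/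

namespace MixedGraph

variable {V : Type*} {X : MixedGraph V}

/-! ### Components of a spanning sub-graph -/

/-- The component of a spanning sub-graph that contains a given vertex. -/
def comp (Y : X.Sub) (hY : Y.IsSpanning) (v : V) : Y.coe.ConnectedComponent :=
  Y.coe.connectedComponentMk ⟨v, hY v⟩

lemma comp_eq_of_adj {Y : X.Sub} (hY : Y.IsSpanning) {u v : V} (h : Y.Adj u v) :
    comp Y hY u = comp Y hY v :=
  SimpleGraph.ConnectedComponent.sound (SimpleGraph.Adj.reachable (by simpa using h))

lemma comp_surjective {Y : X.Sub} (hY : Y.IsSpanning) : Function.Surjective (comp Y hY) := by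
  intro c
  induction c using SimpleGraph.ConnectedComponent.ind with
  | h v => exact ⟨v, rfl⟩

/-- Induction along a walk. Local facts about a permutation are spread over a whole component this
way. -/
lemma comp_induction {Y : X.Sub} (hY : Y.IsSpanning) {P : V → Prop}
    (hP : ∀ x y, Y.Adj x y → P x → P y) {u v : V} (h : comp Y hY u = comp Y hY v) (hu : P u) :
    P v := by
  have hr : Y.coe.Reachable ⟨u, hY u⟩ ⟨v, hY v⟩ := SimpleGraph.ConnectedComponent.exact h
  obtain ⟨w⟩ := hr
  have key : ∀ (a b : Y.verts), Y.coe.Walk a b → P a → P b := by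
    intro a b w
    induction w with
    | nil => exact id
    | cons h _ ih => exact fun ha => ih (hP _ _ (by simpa using h) ha)
  exact key _ _ w hu

lemma mem_componentSub_verts {Y : X.Sub} (hY : Y.IsSpanning) {c : Y.coe.ConnectedComponent}
    {v : V} : v ∈ (X.componentSub Y c).verts ↔ comp Y hY v = c := by
  simp only [componentSub, SimpleGraph.Subgraph.induce_verts, Set.mem_image]
  constructor
  · rintro ⟨x, hx, rfl⟩
    exact hx
  · intro h
    exact ⟨⟨v, hY v⟩, h, rfl⟩

lemma componentSub_adj {Y : X.Sub} (hY : Y.IsSpanning) {c : Y.coe.ConnectedComponent}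
    {u v : V} : (X.componentSub Y c).Adj u v ↔ comp Y hY u = c ∧ Y.Adj u v := by
  have : (X.componentSub Y c).Adj u v ↔
      u ∈ (X.componentSub Y c).verts ∧ v ∈ (X.componentSub Y c).verts ∧ Y.Adj u v := by
    simp [componentSub]
  rw [this, mem_componentSub_verts hY, mem_componentSub_verts hY]
  constructor
  · rintro ⟨h1, -, h2⟩
    exact ⟨h1, h2⟩
  · rintro ⟨h1, h2⟩
    exact ⟨h1, (comp_eq_of_adj hY h2).symm.trans h1, h2⟩

lemma componentSub_le {Y : X.Sub} (hY : Y.IsSpanning) (c : Y.coe.ConnectedComponent) :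
    X.componentSub Y c ≤ Y :=
  ⟨fun v _ => hY v, fun _ _ h => ((componentSub_adj hY).1 h).2⟩

lemma componentSub_injective {Y : X.Sub} (hY : Y.IsSpanning) :
    Function.Injective (X.componentSub Y) := by
  intro c d h
  obtain ⟨v, rfl⟩ := comp_surjective hY c
  have : v ∈ (X.componentSub Y d).verts := h ▸ (mem_componentSub_verts hY).2 rfl
  exact (mem_componentSub_verts hY).1 this

/-! ### Permutations tracing a sub-graph -/

/-- The edges of `Y` are exactly the pairs `{v, σ v}`. -/
def Compat (σ : Equiv.Perm V) (Y : X.Sub) : Prop :=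
  ∀ u v, Y.Adj u v ↔ σ u = v ∨ σ v = u

lemma Compat.symm {σ : Equiv.Perm V} {Y : X.Sub} (h : Compat σ Y) : Compat σ.symm Y := by
  intro u v
  rw [h u v, Equiv.symm_apply_eq, Equiv.symm_apply_eq]
  tauto

lemma Compat.adj {σ : Equiv.Perm V} {Y : X.Sub} (h : Compat σ Y) (v : V) : Y.Adj v (σ v) :=
  (h _ _).2 (Or.inl rfl)

lemma Compat.neighborSet {σ : Equiv.Perm V} {Y : X.Sub} (h : Compat σ Y) (v : V) :
    Y.neighborSet v = {σ v, σ.symm v} := by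
  ext u
  simp only [SimpleGraph.Subgraph.mem_neighborSet, h v u, Set.mem_insert_iff,
    Set.mem_singleton_iff, Equiv.eq_symm_apply]
  tauto

lemma Compat.comp_apply {σ : Equiv.Perm V} {Y : X.Sub} (h : Compat σ Y) (hY : Y.IsSpanning)
    (v : V) : comp Y hY (σ v) = comp Y hY v :=
  (comp_eq_of_adj hY (h.adj v)).symm

/-- Agreement passes to neighbours: if one permutation turned back along the edge just used,
injectivity would make that edge a 2-cycle, on which both agree anyway. -/
lemma Compat.eq_of_apply_eq {σ τ : Equiv.Perm V} {Y : X.Sub} (hσ : Compat σ Y) (hτ : Compat τ Y)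
    (hY : Y.IsSpanning) {u v : V} (huv : comp Y hY u = comp Y hY v) (hu : τ u = σ u) :
    τ v = σ v := by
  refine comp_induction hY (P := fun x => τ x = σ x) ?_ huv hu
  intro x y hxy hx
  have key : σ x = y → τ y = σ y := by
    intro h
    rcases (hτ _ _).1 (hσ.adj y) with h2 | h2
    · exact h2
    · have h3 : σ y = x := τ.injective (by rw [h2, hx, h])
      rcases (hσ _ _).1 (hτ.adj y) with h4 | h4
      · exact h4.symm
      · rw [h3]
        exact σ.injective (h4.trans h.symm)
  rcases (hσ _ _).1 hxy with h | h
  · exact key h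
  · rcases (hτ _ _).1 hxy with h2 | h2
    · exact key (hx ▸ h2)
    · rw [h2, h]

lemma Compat.eq_or_eq_symm {σ τ : Equiv.Perm V} {Y : X.Sub} (hσ : Compat σ Y) (hτ : Compat τ Y)
    (hY : Y.IsSpanning) (c : Y.coe.ConnectedComponent) :
    (∀ v, comp Y hY v = c → τ v = σ v) ∨ (∀ v, comp Y hY v = c → τ v = σ.symm v) := by
  obtain ⟨u, rfl⟩ := comp_surjective hY c
  rcases (hσ _ _).1 (hτ.adj u) with h | h
  · exact Or.inl fun v hv => hσ.eq_of_apply_eq hτ hY hv.symm h.symm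
  · refine Or.inr fun v hv => hσ.symm.eq_of_apply_eq hτ hY hv.symm ?_
    rw [Equiv.eq_symm_apply, h]

/-- The spanning sub-graph with edges `{v, σ v}`. -/
def permSub (X : MixedGraph V) (σ : Equiv.Perm V) : X.Sub where
  verts := Set.univ
  Adj u v := X.underlying.Adj u v ∧ (σ u = v ∨ σ v = u)
  adj_sub h := h.1
  edge_vert _ := Set.mem_univ _
  symm := ⟨fun _ _ h => ⟨h.1.symm, h.2.symm⟩⟩

lemma permSub_isSpanning (σ : Equiv.Perm V) : (X.permSub σ).IsSpanning := fun v => Set.mem_univ v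

lemma compat_permSub {σ : Equiv.Perm V} (h : ∀ v, X.underlying.Adj v (σ v)) :
    Compat σ (X.permSub σ) := by
  intro u v
  constructor
  · exact fun h => h.2
  · rintro (rfl | rfl)
    · exact ⟨h _, Or.inl rfl⟩
    · exact ⟨(h _).symm, Or.inr rfl⟩

lemma Compat.eq_permSub {σ : Equiv.Perm V} {Y : X.Sub} (h : Compat σ Y) (hY : Y.IsSpanning) :
    X.permSub σ = Y := by
  ext u v
  · simp [permSub, hY u]
  · rw [h u v]
    refine ⟨fun h => h.2, fun h' => ⟨Y.adj_sub ((h u v).2 h'), h'⟩⟩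

/-! ### Elementary sub-graphs and permutations -/

/-- A cycle already uses two edges at each of its vertices, so under the degree bound no further
edge of `Y` touches it and it fills its component. Finiteness is assumed because `ncard` is `0` on
infinite sets. -/
lemma cycle_eq_componentSub {Y : X.Sub} (hY : Y.IsSpanning)
    (hdeg : ∀ v, (Y.neighborSet v).Finite ∧ (Y.neighborSet v).ncard ≤ 2) {u : V}
    {w : X.underlying.Walk u u} (hw : w.IsCycle) (hle : w.toSubgraph ≤ Y) :
    w.toSubgraph = X.componentSub Y (comp Y hY u) := by
  have hadj : ∀ x y, x ∈ w.toSubgraph.verts → Y.Adj x y → w.toSubgraph.Adj x y := by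
    intro x y hx hxy
    have h2 := hw.ncard_neighborSet_toSubgraph_eq_two (w.mem_verts_toSubgraph.1 hx)
    have hsub : w.toSubgraph.neighborSet x ⊆ Y.neighborSet x := fun z hz => hle.2 hz
    have := Set.eq_of_subset_of_ncard_le hsub (by rw [h2]; exact (hdeg x).2) (hdeg x).1
    have hy : y ∈ Y.neighborSet x := hxy
    rw [← this] at hy
    exact hy
  have hu : u ∈ w.toSubgraph.verts := w.start_mem_verts_toSubgraph
  have hmem : ∀ x, comp Y hY u = comp Y hY x → x ∈ w.toSubgraph.verts := fun x hx =>
    comp_induction hY (P := fun x => x ∈ w.toSubgraph.verts)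
      (fun x y hxy hx => w.toSubgraph.edge_vert (hadj x y hx hxy).symm) hx hu
  have hconn : ∀ x, x ∈ w.toSubgraph.verts → comp Y hY x = comp Y hY u := by
    have : ∀ {a b : V} (p : X.underlying.Walk a b), p.toSubgraph ≤ Y →
        ∀ x ∈ p.support, comp Y hY x = comp Y hY a := by
      intro a b p
      induction p with
      | nil => intro _ x hx; simp at hx; rw [hx]
      | @cons a b _ h q ih =>
        intro hq x hx
        rw [SimpleGraph.Walk.toSubgraph, sup_le_iff] at hq
        have h1 := comp_eq_of_adj hY
          (hq.1.2 (by simp : (X.underlying.subgraphOfAdj h).Adj a b))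
        rw [SimpleGraph.Walk.support_cons, List.mem_cons] at hx
        rcases hx with rfl | hx
        · rfl
        · rw [ih hq.2 x hx, h1]
    exact fun x hx => this w hle x (w.mem_verts_toSubgraph.1 hx)
  ext x y
  · rw [mem_componentSub_verts hY]
    exact ⟨hconn x, fun h => hmem x h.symm⟩
  · rw [componentSub_adj hY]
    exact ⟨fun h => ⟨hconn x (w.toSubgraph.edge_vert h), hle.2 h⟩,
      fun h => hadj x y (hmem x h.1.symm) h.2⟩

lemma Compat.neighborSet_small {σ : Equiv.Perm V} {Y : X.Sub} (h : Compat σ Y) (v : V) :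
    (Y.neighborSet v).Finite ∧ (Y.neighborSet v).ncard ≤ 2 := by
  rw [h.neighborSet]
  exact ⟨Set.toFinite _, Set.ncard_insert_le _ _ |>.trans (by simp)⟩

lemma Compat.componentSub_eq_edge {σ : Equiv.Perm V} {Y : X.Sub} (h : Compat σ Y)
    (hY : Y.IsSpanning) {v : V} (hv : σ (σ v) = v) :
    X.componentSub Y (comp Y hY v) = X.underlying.subgraphOfAdj (Y.adj_sub (h.adj v)) := by
  have hc : ∀ x, comp Y hY v = comp Y hY x → x = v ∨ x = σ v := fun x hx => by
    refine comp_induction hY (P := fun x => x = v ∨ x = σ v) ?_ hx (Or.inl rfl)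
    intro a b hab ha
    rcases (h _ _).1 hab with h1 | h1
    · rcases ha with rfl | rfl
      · exact Or.inr h1.symm
      · exact Or.inl (h1.symm.trans hv)
    · rcases ha with rfl | rfl
      · exact Or.inr (σ.injective (h1.trans hv.symm))
      · exact Or.inl (σ.injective h1)
  ext x y
  · rw [mem_componentSub_verts hY]
    simp only [SimpleGraph.subgraphOfAdj_verts, Set.mem_insert_iff, Set.mem_singleton_iff]
    refine ⟨fun hx => hc x hx.symm, ?_⟩
    rintro (rfl | rfl)
    · rfl
    · exact h.comp_apply hY v
  · rw [componentSub_adj hY]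
    simp only [SimpleGraph.subgraphOfAdj_adj, Sym2.eq_iff]
    constructor
    · rintro ⟨hx, hxy⟩
      have h2 := (h _ _).1 hxy
      rcases hc x hx.symm with rfl | rfl
      · rcases h2 with h2 | h2
        · exact Or.inl ⟨rfl, h2⟩
        · exact Or.inl ⟨rfl, σ.injective (hv.trans h2.symm)⟩
      · rcases h2 with h2 | h2
        · exact Or.inr ⟨hv.symm.trans h2, rfl⟩
        · exact Or.inr ⟨(σ.injective h2).symm, rfl⟩
    · rintro (⟨rfl, rfl⟩ | ⟨rfl, rfl⟩)
      · exact ⟨rfl, h.adj _⟩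
      · exact ⟨h.comp_apply hY v, (h.adj _).symm⟩

lemma Compat.isElementary [Finite V] {σ : Equiv.Perm V} {Y : X.Sub} (h : Compat σ Y)
    (hY : Y.IsSpanning) : X.IsElementary Y := by
  intro c
  obtain ⟨v, rfl⟩ := comp_surjective hY c
  by_cases hv : σ (σ v) = v
  · exact Or.inl ⟨v, σ v, _, h.componentSub_eq_edge hY hv⟩
  · right
    -- Not lying on a 2-cycle spreads along edges, so every vertex of the component has two distinct
    -- neighbours.
    have hne : ∀ x, comp Y hY v = comp Y hY x → σ (σ x) ≠ x := fun x hx => by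
      refine comp_induction hY (P := fun x => σ (σ x) ≠ x) ?_ hx hv
      intro a b hab ha hb
      rcases (h _ _).1 hab with rfl | rfl
      · exact ha (σ.injective hb)
      · exact ha (by rw [hb])
    let G : SimpleGraph V := (X.componentSub Y (comp Y hY v)).spanningCoe
    have hG : ∀ x y, G.Adj x y ↔ comp Y hY x = comp Y hY v ∧ Y.Adj x y := fun x y =>
      componentSub_adj hY
    have hcyc : G.IsCycles := by
      intro x hx
      obtain ⟨y, hy⟩ := hx
      have hx := ((hG x y).1 hy).1
      have : G.neighborSet x = Y.neighborSet x := by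
        ext z
        simp only [SimpleGraph.mem_neighborSet, hG, hx, true_and,
          SimpleGraph.Subgraph.mem_neighborSet]
      rw [this, h.neighborSet, Set.ncard_pair]
      intro h1
      rw [Equiv.eq_symm_apply] at h1
      exact hne x hx.symm h1
    obtain ⟨p, hp, -⟩ := hcyc.exists_cycle_toSubgraph_verts_eq_connectedComponentSupp
      (v := v) (c := G.connectedComponentMk v) rfl ⟨σ v, (hG _ _).2 ⟨rfl, h.adj v⟩⟩
    have hle : G ≤ X.underlying := fun x y hxy => Y.adj_sub ((hG x y).1 hxy).2
    refine ⟨v, p.mapLe hle, (SimpleGraph.Walk.isCycle_mapLe hle).2 hp, ?_⟩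
    -- Any cycle through `v` inside `Y` will do, since it must be the whole component.
    refine cycle_eq_componentSub hY h.neighborSet_small
      ((SimpleGraph.Walk.isCycle_mapLe hle).2 hp) ⟨fun x _ => hY x, fun x y hxy => ?_⟩
    rw [SimpleGraph.Walk.adj_toSubgraph_iff_mem_edges, SimpleGraph.Walk.edges_mapLe_eq_edges] at hxy
    exact ((hG x y).1 (p.adj_of_mem_edges hxy)).2

/-- `f` is the successor along `w`. The tails of the darts of a cycle are distinct, and so are the
heads; this makes `f` agree with every dart and be injective. -/
lemma exists_next_of_isCycle {u : V} {w : X.underlying.Walk u u} (hw : w.IsCycle) :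
    ∃ f : V → V, (∀ v ∈ w.toSubgraph.verts, f v ∈ w.toSubgraph.verts) ∧
      Set.InjOn f w.toSubgraph.verts ∧
      ∀ x ∈ w.toSubgraph.verts, ∀ y ∈ w.toSubgraph.verts,
        (w.toSubgraph.Adj x y ↔ f x = y ∨ f y = x) := by
  have hnf : (w.darts.map (·.fst)).Nodup := by
    rw [SimpleGraph.Walk.map_fst_darts]; exact hw.nodup_dropLast_support
  have hns : (w.darts.map (·.snd)).Nodup := by
    rw [SimpleGraph.Walk.map_snd_darts]; exact hw.support_nodup
  have hex : ∀ v, ∃ b, v ∈ w.toSubgraph.verts → ∃ d ∈ w.darts, d.fst = v ∧ d.snd = b := by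
    intro v
    by_cases hv : v ∈ w.toSubgraph.verts
    · have hmem : v ∈ w.darts.map (·.fst) := by
        rw [SimpleGraph.Walk.mem_verts_toSubgraph, ← SimpleGraph.Walk.map_fst_darts_append,
          List.mem_append] at hv
        rcases hv with hv | hv
        · exact hv
        · rw [List.mem_singleton] at hv
          subst hv
          refine List.mem_map.2 ⟨w.firstDart hw.not_nil, w.firstDart_mem_darts _, rfl⟩
      obtain ⟨d, hd, rfl⟩ := List.mem_map.1 hmem
      exact ⟨d.snd, fun _ => ⟨d, hd, rfl, rfl⟩⟩
    · exact ⟨v, fun h => absurd h hv⟩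
  choose f hf using hex
  have hkey : ∀ d ∈ w.darts, f d.fst = d.snd := by
    intro d hd
    obtain ⟨e, he, h1, h2⟩ := hf d.fst
      (w.mem_verts_toSubgraph.2 (w.dart_fst_mem_support_of_mem_darts hd))
    rw [← h2, List.inj_on_of_nodup_map hnf he hd h1]
  refine ⟨f, ?_, ?_, ?_⟩
  · intro v hv
    obtain ⟨d, hd, -, h2⟩ := hf v hv
    rw [← h2]
    exact w.mem_verts_toSubgraph.2 (w.dart_snd_mem_support_of_mem_darts hd)
  · intro x hx y hy hxy
    obtain ⟨d, hd, h1, h2⟩ := hf x hx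
    obtain ⟨e, he, h3, h4⟩ := hf y hy
    have : d = e := List.inj_on_of_nodup_map hns hd he (by rw [h2, h4, hxy])
    rw [← h1, ← h3, this]
  · intro x hx y hy
    rw [SimpleGraph.Walk.adj_toSubgraph_iff_mem_edges, SimpleGraph.Walk.edges, List.mem_map]
    constructor
    · rintro ⟨d, hd, h⟩
      rw [SimpleGraph.dart_edge_eq_mk'_iff'] at h
      rcases h with ⟨rfl, rfl⟩ | ⟨rfl, rfl⟩
      · exact Or.inl (hkey d hd)
      · exact Or.inr (hkey d hd)
    · rintro (h | h)
      · obtain ⟨d, hd, h1, h2⟩ := hf x hx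
        exact ⟨d, hd, by rw [SimpleGraph.dart_edge_eq_mk'_iff']; exact Or.inl ⟨h1, h2.trans h⟩⟩
      · obtain ⟨d, hd, h1, h2⟩ := hf y hy
        exact ⟨d, hd, by rw [SimpleGraph.dart_edge_eq_mk'_iff']; exact Or.inr ⟨h1, h2.trans h⟩⟩

/-- Glue a swap on each edge component with a successor map on each cycle. Each piece preserves its
component, so the result is injective, hence bijective by finiteness. -/
lemma exists_compat [Finite V] {Y : X.Sub} (hY : Y.IsSpanning) (he : X.IsElementary Y) :
    ∃ σ : Equiv.Perm V, Compat σ Y := by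
  classical
  have hex : ∀ c : Y.coe.ConnectedComponent, ∃ f : V → V,
      (∀ v ∈ (X.componentSub Y c).verts, f v ∈ (X.componentSub Y c).verts) ∧
      Set.InjOn f (X.componentSub Y c).verts ∧
      ∀ x ∈ (X.componentSub Y c).verts, ∀ y ∈ (X.componentSub Y c).verts,
        ((X.componentSub Y c).Adj x y ↔ f x = y ∨ f y = x) := by
    intro c
    rcases he c with ⟨u, v, h, hc⟩ | ⟨u, w, hw, hc⟩
    · rw [hc]
      have hne := h.ne
      refine ⟨Equiv.swap u v, ?_, (Equiv.swap u v).injective.injOn, ?_⟩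
      · rintro x (rfl | rfl) <;> simp
      · rintro x (rfl | rfl) y (rfl | rfl) <;> simp [hne, hne.symm]
    · rw [← hc]
      exact exists_next_of_isCycle hw
  choose f hf1 hf2 hf3 using hex
  have hcomp : ∀ v, comp Y hY (f (comp Y hY v) v) = comp Y hY v := fun v =>
    (mem_componentSub_verts hY).1 (hf1 _ _ ((mem_componentSub_verts hY).2 rfl))
  have hinj : Function.Injective fun v => f (comp Y hY v) v := by
    intro x y hxy
    have hc : comp Y hY x = comp Y hY y := by
      rw [← hcomp x, ← hcomp y]
      exact congrArg _ hxy
    simp only [hc] at hxy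
    exact hf2 (comp Y hY y) ((mem_componentSub_verts hY).2 hc) ((mem_componentSub_verts hY).2 rfl)
      hxy
  refine ⟨Equiv.ofBijective _ (Finite.injective_iff_bijective.1 hinj), fun x y => ?_⟩
  simp only [Equiv.ofBijective_apply]
  by_cases hc : comp Y hY x = comp Y hY y
  · have := hf3 (comp Y hY y) x ((mem_componentSub_verts hY).2 hc) y
      ((mem_componentSub_verts hY).2 rfl)
    rw [componentSub_adj hY] at this
    rw [hc, ← this]
    exact ⟨fun h => ⟨hc, h⟩, fun h => h.2⟩
  · refine iff_of_false (fun h => hc (comp_eq_of_adj hY h)) ?_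
    rintro (h | h)
    · exact hc (by rw [← h, hcomp])
    · exact hc (by rw [← h, hcomp])

/-- A change of direction between consecutive steps would identify two vertices two steps apart,
which a cycle forbids. -/
lemma Compat.walk_directed {σ : Equiv.Perm V} {Y : X.Sub} (h : Compat σ Y) {u : V}
    {w : X.underlying.Walk u u} (hw : w.IsCycle) (hle : w.toSubgraph ≤ Y) :
    (∀ d ∈ w.darts, σ d.fst = d.snd) ∨ (∀ d ∈ w.darts, σ d.snd = d.fst) := by
  have hadj : ∀ i < w.length,
      σ (w.getVert i) = w.getVert (i + 1) ∨ σ (w.getVert (i + 1)) = w.getVert i := fun i hi =>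
    (h _ _).1 (hle.2 (w.toSubgraph_adj_getVert hi))
  have hne : ∀ i, i + 1 < w.length → w.getVert i ≠ w.getVert (i + 2) := fun i hi =>
    hw.getVert_sub_one_ne_getVert_add_one (i := i + 1) hi.le
  have h0 : 0 < w.length := by have := hw.three_le_length; omega
  have hd : ∀ d ∈ w.darts, ∃ i < w.length, d.fst = w.getVert i ∧ d.snd = w.getVert (i + 1) := by
    intro d hd
    obtain ⟨i, hi, rfl⟩ := List.getElem_of_mem hd
    rw [SimpleGraph.Walk.length_darts] at hi
    refine ⟨i, hi, ?_⟩
    rw [SimpleGraph.Walk.darts_getElem_eq_getVert]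
    exact ⟨rfl, rfl⟩
  rcases hadj 0 h0 with h1 | h1
  · left
    have : ∀ i < w.length, σ (w.getVert i) = w.getVert (i + 1) := by
      intro i
      induction i with
      | zero => exact fun _ => h1
      | succ i ih =>
        intro hi
        rcases hadj (i + 1) hi with h2 | h2
        · exact h2
        · exact absurd (σ.injective ((ih (by omega)).trans h2.symm)) (hne i hi)
    intro d hd'
    obtain ⟨i, hi, e1, e2⟩ := hd d hd'
    rw [e1, e2, this i hi]
  · right
    have : ∀ i < w.length, σ (w.getVert (i + 1)) = w.getVert i := by
      intro i
      induction i with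
      | zero => exact fun _ => h1
      | succ i ih =>
        intro hi
        rcases hadj (i + 1) hi with h2 | h2
        · exact absurd ((ih (by omega)).symm.trans h2) (hne i hi)
        · exact h2
    intro d hd'
    obtain ⟨i, hi, e1, e2⟩ := hd d hd'
    rw [e1, e2, this i hi]

/-! ### Orbits and the sign -/

lemma Compat.sameCycle_iff {σ : Equiv.Perm V} {Y : X.Sub} (h : Compat σ Y) (hY : Y.IsSpanning)
    {u v : V} : σ.SameCycle u v ↔ comp Y hY u = comp Y hY v := by
  constructor
  · rintro ⟨i, rfl⟩
    induction i with
    | zero => rfl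
    | succ i ih => rw [add_comm, zpow_add, zpow_one, Equiv.Perm.mul_apply, h.comp_apply, ih]
    | pred i ih =>
      rw [ih, ← h.comp_apply hY ((σ ^ (-(i : ℤ) - 1)) u), ← Equiv.Perm.mul_apply, ← zpow_one_add]
      congr 3
      ring
  · intro huv
    refine comp_induction hY (P := fun x => σ.SameCycle u x) ?_ huv (Equiv.Perm.SameCycle.refl _ _)
    intro x y hxy hx
    rcases (h _ _).1 hxy with rfl | rfl
    · exact Equiv.Perm.sameCycle_apply_right.2 hx
    · exact Equiv.Perm.sameCycle_apply_right.1 hx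

open Classical in
lemma Compat.card_cycleFactorsFinset [Fintype V] {σ : Equiv.Perm V} {Y : X.Sub} (h : Compat σ Y)
    (hY : Y.IsSpanning) : σ.cycleFactorsFinset.card = Nat.card Y.coe.ConnectedComponent := by
  have hsupp : ∀ v, v ∈ σ.support := fun v => by
    rw [Equiv.Perm.mem_support]
    exact (Y.adj_sub (h.adj v)).ne'
  rw [Nat.card_eq_fintype_card, ← Finset.card_univ]
  symm
  have hrep := Function.surjInv_eq (comp_surjective hY)
  refine Finset.card_bij (fun c _ => σ.cycleOf (Function.surjInv (comp_surjective hY) c)) ?_ ?_ ?_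
  · intro c _
    exact Equiv.Perm.cycleOf_mem_cycleFactorsFinset_iff.2 (hsupp _)
  · intro c _ d _ hcd
    rw [← Equiv.Perm.sameCycle_iff_cycleOf_eq_of_mem_support (hsupp _) (hsupp _),
      h.sameCycle_iff hY, hrep, hrep] at hcd
    exact hcd
  · intro τ hτ
    obtain ⟨v, hv⟩ := (Equiv.Perm.mem_cycleFactorsFinset_iff.1 hτ).1.nonempty_support
    refine ⟨comp Y hY v, Finset.mem_univ _, ?_⟩
    rw [Equiv.Perm.cycle_is_cycleOf hv hτ,
      ← Equiv.Perm.sameCycle_iff_cycleOf_eq_of_mem_support (hsupp _) (hsupp _),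
      h.sameCycle_iff hY, hrep]

open Classical in
-- There are no loops, so `σ` has no fixed points and its nontrivial cycles account for all
-- components.
lemma Compat.sign_eq [Fintype V] {σ : Equiv.Perm V} {Y : X.Sub} (h : Compat σ Y)
    (hY : Y.IsSpanning) : ((Equiv.Perm.sign σ : ℤ) : ℂ) = (-1) ^ X.rank Y := by
  have hsupp : σ.support = Finset.univ := by
    ext v
    simp only [Equiv.Perm.mem_support, Finset.mem_univ, iff_true]
    exact (Y.adj_sub (h.adj v)).ne'
  have hle : Nat.card Y.coe.ConnectedComponent ≤ Fintype.card V := by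
    rw [← Nat.card_eq_fintype_card]
    exact Nat.card_le_card_of_surjective _ (comp_surjective hY)
  have hcard : Multiset.card σ.cycleType = Nat.card Y.coe.ConnectedComponent := by
    rw [← h.card_cycleFactorsFinset hY, Equiv.Perm.cycleType_def, Multiset.card_map]
    rfl
  have hverts : Y.verts.ncard = Fintype.card V := by
    rw [SimpleGraph.Subgraph.isSpanning_iff.1 hY, Set.ncard_univ, Nat.card_eq_fintype_card]
  rw [Equiv.Perm.sign_of_cycleType, Equiv.Perm.sum_cycleType, hsupp, hcard, Finset.card_univ,
    rank, hverts]
  push_cast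
  -- The sign has exponent `n + c`, the rank is `n - c`; they differ by the even number `2c`.
  obtain ⟨k, hk⟩ := Nat.exists_eq_add_of_le hle
  rw [hk, Nat.add_sub_cancel_left, add_right_comm, pow_add, ← two_mul, pow_mul]
  simp

/-! ### Reorienting components -/

/-- Decides whether the two directions on a component differ: a vertex has two neighbours on a cycle
and one on an edge. -/
lemma Compat.isCycleSub_iff [Finite V] {σ : Equiv.Perm V} {Y : X.Sub} (h : Compat σ Y)
    (hY : Y.IsSpanning) (v : V) :
    X.IsCycleSub (X.componentSub Y (comp Y hY v)) ↔ σ v ≠ σ.symm v := by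
  constructor
  · rintro ⟨u, w, hw, hc⟩ hv
    have hmem : v ∈ w.toSubgraph.verts := by
      rw [hc]
      exact (mem_componentSub_verts hY).2 rfl
    have h2 := hw.ncard_neighborSet_toSubgraph_eq_two (w.mem_verts_toSubgraph.1 hmem)
    have hsub : w.toSubgraph.neighborSet v ⊆ Y.neighborSet v := fun z hz =>
      (hc ▸ componentSub_le hY _ : w.toSubgraph ≤ Y).2 hz
    rw [h.neighborSet, hv, Set.pair_eq_singleton] at hsub
    have := Set.ncard_le_ncard hsub
    rw [h2, Set.ncard_singleton] at this
    omega
  · intro hv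
    rcases h.isElementary hY (comp Y hY v) with ⟨a, b, hab, hc⟩ | hc
    · exfalso
      have hall : ∀ x, Y.Adj v x → x ∈ ({a, b} : Set V) ∧ x ≠ v := by
        intro x hx
        refine ⟨?_, (Y.adj_sub hx).ne'⟩
        have : x ∈ (X.componentSub Y (comp Y hY v)).verts :=
          (mem_componentSub_verts hY).2 (comp_eq_of_adj hY hx).symm
        rw [hc] at this
        exact this
      have hvm : v ∈ ({a, b} : Set V) := by
        have : v ∈ (X.componentSub Y (comp Y hY v)).verts := (mem_componentSub_verts hY).2 rfl
        rw [hc] at this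
        exact this
      have h1 := hall _ (h.adj v)
      have h2 := hall _ (h.symm.adj v)
      simp only [Set.mem_insert_iff, Set.mem_singleton_iff] at h1 h2 hvm
      grind
    · exact hc

/-- The permutation that follows `σ` or its inverse on each component, as prescribed by `p`. -/
def Compat.orient {σ : Equiv.Perm V} {Y : X.Sub} (h : Compat σ Y)
    (hY : Y.IsSpanning) (p : Y.coe.ConnectedComponent → Bool) : Equiv.Perm V where
  toFun v := if p (comp Y hY v) then σ v else σ.symm v
  invFun v := if p (comp Y hY v) then σ.symm v else σ v
  left_inv v := by
    cases hp : p (comp Y hY v) <;> simp [h.comp_apply hY, h.symm.comp_apply hY, hp]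
  right_inv v := by
    cases hp : p (comp Y hY v) <;> simp [h.comp_apply hY, h.symm.comp_apply hY, hp]

lemma Compat.orient_apply {σ : Equiv.Perm V} {Y : X.Sub} (h : Compat σ Y)
    (hY : Y.IsSpanning) (p : Y.coe.ConnectedComponent → Bool) (v : V) :
    h.orient hY p v = if p (comp Y hY v) then σ v else σ.symm v := rfl

lemma Compat.compat_orient {σ : Equiv.Perm V} {Y : X.Sub} (h : Compat σ Y)
    (hY : Y.IsSpanning) (p : Y.coe.ConnectedComponent → Bool) : Compat (h.orient hY p) Y := by
  intro x y
  by_cases hc : comp Y hY x = comp Y hY y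
  · rw [h.orient_apply, h.orient_apply, hc]
    cases p (comp Y hY y)
    · simpa using h.symm x y
    · simpa using h x y
  · refine iff_of_false (fun h => hc (comp_eq_of_adj hY h)) ?_
    have hcomp : ∀ v, comp Y hY (h.orient hY p v) = comp Y hY v := by
      intro v
      rw [h.orient_apply]
      split_ifs
      · exact h.comp_apply hY v
      · exact h.symm.comp_apply hY v
    rintro (h | h)
    · exact hc (by rw [← h, hcomp])
    · exact hc (by rw [← h, hcomp])

open Classical in
lemma Compat.sum_prod [Fintype V] {σ : Equiv.Perm V} {Y : X.Sub} (h : Compat σ Y)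
    (hY : Y.IsSpanning) (f : V → V → ℂ) :
    ∑ τ : Equiv.Perm V with Compat τ Y, ∏ v, f v (τ v) =
      ∏ c : Y.coe.ConnectedComponent,
        ((∏ v with comp Y hY v = c, f v (σ v)) +
          if X.IsCycleSub (X.componentSub Y c) then ∏ v with comp Y hY v = c, f v (σ.symm v)
          else 0) := by
  -- On an edge both directions are the same map, so only `true` is admitted; this keeps `p ↦
  -- h.orient hY p` injective.
  let t : Y.coe.ConnectedComponent → Finset Bool := fun c =>
    if X.IsCycleSub (X.componentSub Y c) then Finset.univ else {true}
  have hsum : ∀ c : Y.coe.ConnectedComponent,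
      ((∏ v with comp Y hY v = c, f v (σ v)) +
          if X.IsCycleSub (X.componentSub Y c) then ∏ v with comp Y hY v = c, f v (σ.symm v)
          else 0) =
      ∑ b ∈ t c, ∏ v with comp Y hY v = c, f v (if b then σ v else σ.symm v) := by
    intro c
    by_cases hc : X.IsCycleSub (X.componentSub Y c) <;> simp [t, hc]
  rw [Finset.prod_congr rfl fun c _ => hsum c, Finset.prod_univ_sum]
  symm
  refine Finset.sum_bij (fun p _ => h.orient hY p) ?_ ?_ ?_ ?_
  · intro p _
    simpa using h.compat_orient hY p
  · intro p hp q hq hpq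
    rw [Fintype.mem_piFinset] at hp hq
    funext c
    obtain ⟨v, rfl⟩ := comp_surjective hY c
    have hp' := hp (comp Y hY v)
    have hq' := hq (comp Y hY v)
    by_cases hc : X.IsCycleSub (X.componentSub Y (comp Y hY v))
    · have hv := (h.isCycleSub_iff hY v).1 hc
      have := congrArg (fun τ => τ v) hpq
      simp only [h.orient_apply] at this
      cases h1 : p (comp Y hY v) <;> cases h2 : q (comp Y hY v) <;> simp_all
    · simp only [t, hc, if_false, Finset.mem_singleton] at hp' hq'
      rw [hp', hq']
  · intro τ hτ
    have hτ' : Compat τ Y := (Finset.mem_filter.1 hτ).2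
    let p : Y.coe.ConnectedComponent → Bool := fun c =>
      decide (∀ v, comp Y hY v = c → τ v = σ v)
    refine ⟨p, ?_, ?_⟩
    · rw [Fintype.mem_piFinset]
      intro c
      by_cases hc : X.IsCycleSub (X.componentSub Y c)
      · simp [t, hc]
      · simp only [t, hc, if_false, Finset.mem_singleton, p, decide_eq_true_eq]
        rcases h.eq_or_eq_symm hτ' hY c with h1 | h1
        · exact h1
        · intro v hv
          rw [h1 v hv]
          subst hv
          rw [h.isCycleSub_iff hY, not_not] at hc
          exact hc.symm
    · ext v
      rw [h.orient_apply]
      simp only [p, decide_eq_true_eq]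
      split_ifs with h1
      · exact (h1 v rfl).symm
      · exact (((h.eq_or_eq_symm hτ' hY _).resolve_left h1) v rfl).symm
  · intro p _
    rw [← Finset.prod_fiberwise (Finset.univ : Finset V) (comp Y hY)]
    refine Finset.prod_congr rfl fun c _ => Finset.prod_congr rfl fun v hv => ?_
    rw [h.orient_apply, (Finset.mem_filter.1 hv).2]

/-! ### Sixth roots of unity -/

lemma omega_re : omega.re = 1 / 2 := by
  simp [omega]

lemma omega_im : omega.im = Real.sqrt 3 / 2 := by
  simp [omega]

lemma conj_omega : (starRingEnd ℂ) omega = 1 - omega := by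
  apply Complex.ext
  · simp only [Complex.conj_re, Complex.sub_re, Complex.one_re, omega_re]; norm_num
  · simp

lemma omega_sq : omega ^ 2 = omega - 1 := by
  have h3 : Real.sqrt 3 * Real.sqrt 3 = 3 := Real.mul_self_sqrt (by norm_num)
  rw [sq]
  apply Complex.ext
  · simp only [Complex.mul_re, Complex.sub_re, Complex.one_re, omega_re, omega_im]
    linear_combination (-1 / 4) * h3
  · simp only [Complex.mul_im, Complex.sub_im, Complex.one_im, omega_re, omega_im]
    ring

lemma eq_of_pow_six_eq_one {x : ℂ} (hx : x ^ 6 = 1) :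
    x = 1 ∨ x = -1 ∨ x = omega ∨ x = -omega ∨ x = (starRingEnd ℂ) omega ∨
      x = -(starRingEnd ℂ) omega := by
  have h : (x - 1) * ((x + 1) * ((x - omega) * ((x + omega) * ((x - (1 - omega)) *
      (x + (1 - omega)))))) = 0 := by
    -- Paired factors give `(x² - 1)(x² - ω²)(x² - ω̄²)`, where `ω² + ω̄² = -1` and `ω²ω̄² = 1`.
    linear_combination hx + (-(x ^ 2 - 1) * (2 * x ^ 2 + 1 - omega ^ 2 + omega)) * omega_sq
  rw [conj_omega]
  simp only [mul_eq_zero] at h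
  rcases h with h | h | h | h | h | h
  · exact Or.inl (sub_eq_zero.1 h)
  · exact Or.inr <| Or.inl (eq_neg_of_add_eq_zero_left h)
  · exact Or.inr <| Or.inr <| Or.inl (sub_eq_zero.1 h)
  · exact Or.inr <| Or.inr <| Or.inr <| Or.inl (eq_neg_of_add_eq_zero_left h)
  · exact Or.inr <| Or.inr <| Or.inr <| Or.inr <| Or.inl (sub_eq_zero.1 h)
  · exact Or.inr <| Or.inr <| Or.inr <| Or.inr <| Or.inr (eq_neg_of_add_eq_zero_left h)

lemma exists_pos_mul_iff {x : ℂ} {q : ℝ} (hq : 0 < q) :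
    (∃ r : ℝ, 0 < r ∧ x * q = (r : ℂ)) ↔ x.im = 0 ∧ 0 < x.re := by
  constructor
  · rintro ⟨r, hr, h⟩
    have h1 := congrArg Complex.re h
    have h2 := congrArg Complex.im h
    simp only [Complex.re_mul_ofReal, Complex.im_mul_ofReal, Complex.ofReal_re,
      Complex.ofReal_im, mul_eq_zero, hq.ne', or_false] at h1 h2
    exact ⟨h2, pos_of_mul_pos_left (h1 ▸ hr) hq.le⟩
  · rintro ⟨h1, h2⟩
    refine ⟨x.re * q, mul_pos h2 hq, ?_⟩
    apply Complex.ext <;> simp [h1]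

lemma exists_neg_mul_iff {x : ℂ} {q : ℝ} (hq : 0 < q) :
    (∃ r : ℝ, r < 0 ∧ x * q = (r : ℂ)) ↔ x.im = 0 ∧ x.re < 0 := by
  have := exists_pos_mul_iff (x := -x) hq
  rw [Complex.neg_im, Complex.neg_re, neg_eq_zero, Left.neg_pos_iff] at this
  rw [← this]
  constructor
  · rintro ⟨r, hr, h⟩
    exact ⟨-r, by linarith, by rw [neg_mul, h]; simp⟩
  · rintro ⟨r, hr, h⟩
    exact ⟨-r, by linarith, by rw [Complex.ofReal_neg, ← h, neg_mul, neg_neg]⟩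

lemma mul_ofReal_eq_iff {x y : ℂ} {q : ℝ} (hq : 0 < q) :
    x * (q : ℂ) = y * (q : ℂ) ↔ x.re = y.re ∧ x.im = y.im := by
  rw [mul_left_inj' (by exact_mod_cast hq.ne'), Complex.ext_iff]

open Classical in
lemma add_conj_eq {x : ℂ} (hx : x ^ 6 = 1) {q : ℝ} (hq : 0 < q) :
    x * q + (starRingEnd ℂ) (x * q) =
      (-1) ^ ((if ∃ r : ℝ, r < 0 ∧ x * q = (r : ℂ) then 1 else 0) +
        (if x * q = -omega * q ∨ x * q = -(starRingEnd ℂ) omega * q then 1 else 0)) *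
      2 ^ ((if ∃ r : ℝ, r < 0 ∧ x * q = (r : ℂ) then 1 else 0) +
        (if ∃ r : ℝ, 0 < r ∧ x * q = (r : ℂ) then 1 else 0)) * (q : ℂ) := by
  have h3 : 0 < Real.sqrt 3 := Real.sqrt_pos.2 (by norm_num)
  have h3' : -(Real.sqrt 3 / 2) ≠ Real.sqrt 3 / 2 := by
    intro h
    linarith
  have h3'' : Real.sqrt 3 / 2 ≠ -(Real.sqrt 3 / 2) := h3'.symm
  simp only [exists_neg_mul_iff hq, exists_pos_mul_iff hq, mul_ofReal_eq_iff hq]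
  rw [map_mul, Complex.conj_ofReal, ← add_mul]
  congr 1
  rcases eq_of_pow_six_eq_one hx with rfl | rfl | rfl | rfl | rfl | rfl <;>
    simp only [Complex.one_re, Complex.one_im, Complex.neg_re, Complex.neg_im, Complex.conj_re,
      Complex.conj_im, omega_re, omega_im, map_one, map_neg, Complex.conj_conj, neg_zero,
      neg_neg] <;>
    norm_num [conj_omega, h3.ne', h3', h3''] <;>
    ring

/-! ### Matrix entries and component weights -/

lemma hermitianAdj_conj (u v : V) :
    (starRingEnd ℂ) (X.hermitianAdj u v) = X.hermitianAdj v u := by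
  have h1 : X.Und u v ↔ X.Und v u := ⟨X.und_symm u v, X.und_symm v u⟩
  have h2 := X.arc_asymm u v
  simp only [hermitianAdj, Matrix.of_apply, h1]
  split_ifs <;> simp_all

lemma hermitianAdj_pow_six {u v : V} (h : X.underlying.Adj u v) : X.hermitianAdj u v ^ 6 = 1 := by
  have h1 : omega ^ 6 = 1 := by
    linear_combination (omega ^ 4 + omega ^ 3 - omega - 1) * omega_sq
  have h2 : (starRingEnd ℂ) omega ^ 6 = 1 := by
    rw [← map_pow, h1, map_one]
  have h' : X.Und u v ∨ X.Arc u v ∨ X.Arc v u := h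
  simp only [hermitianAdj, Matrix.of_apply]
  split_ifs
  · simp
  · exact h1
  · exact h2
  · tauto

lemma hermitianAdj_mul_symm {u v : V} (h : X.underlying.Adj u v) :
    X.hermitianAdj u v * X.hermitianAdj v u = 1 := by
  rw [← hermitianAdj_conj u v, Complex.mul_conj, Complex.normSq_eq_norm_sq]
  have h6 : ‖X.hermitianAdj u v‖ ^ 6 = 1 := by
    rw [← norm_pow, hermitianAdj_pow_six h, norm_one]
  rw [(pow_eq_one_iff_of_nonneg (norm_nonneg _) (by norm_num)).1 h6]
  simp

lemma randic_conj (u v : V) : (starRingEnd ℂ) (X.randic u v) = X.randic v u := by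
  simp only [randic, Matrix.of_apply, map_div₀, hermitianAdj_conj, Complex.conj_ofReal]
  rw [mul_comm]

lemma randic_eq_zero {u v : V} (h : ¬ X.underlying.Adj u v) : X.randic u v = 0 := by
  have h' : ¬ (X.Und u v ∨ X.Arc u v ∨ X.Arc v u) := h
  simp only [not_or] at h'
  simp [randic, hermitianAdj, h']

open Classical in
lemma Q_componentSub [Fintype V] {Y : X.Sub} (hY : Y.IsSpanning) (c : Y.coe.ConnectedComponent) :
    X.Q (X.componentSub Y c) = ∏ v with comp Y hY v = c, 1 / (X.degree v : ℝ) := by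
  rw [Q, ← finprod_mem_coe_finset]
  refine finprod_mem_congr ?_ fun _ _ => rfl
  ext v
  simp [mem_componentSub_verts hY]

lemma degree_pos [Finite V] {u v : V} (h : X.underlying.Adj u v) : 0 < X.degree u := by
  rw [degree, Set.ncard_pos]
  exact ⟨v, h⟩

open Classical in
lemma Q_componentSub_pos [Fintype V] {σ : Equiv.Perm V} {Y : X.Sub} (h : Compat σ Y)
    (hY : Y.IsSpanning) (c : Y.coe.ConnectedComponent) : 0 < X.Q (X.componentSub Y c) := by
  rw [Q_componentSub hY]
  refine Finset.prod_pos fun v _ => ?_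
  have := degree_pos (Y.adj_sub (h.adj v))
  positivity

open Classical in
lemma Q_eq_prod [Fintype V] {Y : X.Sub} (hY : Y.IsSpanning) :
    X.Q Y = ∏ c : Y.coe.ConnectedComponent, X.Q (X.componentSub Y c) := by
  rw [Finset.prod_congr rfl fun c _ => Q_componentSub hY c,
    Finset.prod_fiberwise Finset.univ (comp Y hY) fun v => 1 / (X.degree v : ℝ), Q,
    SimpleGraph.Subgraph.isSpanning_iff.1 hY, finprod_mem_univ, finprod_eq_prod_of_fintype]

open Classical in
lemma Compat.prod_comp_apply [Fintype V] {σ : Equiv.Perm V} {Y : X.Sub} (h : Compat σ Y)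
    (hY : Y.IsSpanning) (c : Y.coe.ConnectedComponent) {M : Type*} [CommMonoid M] (f : V → M) :
    ∏ v with comp Y hY v = c, f (σ v) = ∏ v with comp Y hY v = c, f v :=
  Finset.prod_equiv σ (by simp [h.comp_apply hY]) (by simp)

open Classical in
-- Split the square root into `√d_v` and `√d_{σ v}`. As `σ` permutes the component, both parts have
-- the same product, and together they give `Q`.
lemma Compat.prod_randic [Fintype V] {σ : Equiv.Perm V} {Y : X.Sub} (h : Compat σ Y)
    (hY : Y.IsSpanning) (c : Y.coe.ConnectedComponent) :
    ∏ v with comp Y hY v = c, X.randic v (σ v) =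
      (∏ v with comp Y hY v = c, X.hermitianAdj v (σ v)) * (X.Q (X.componentSub Y c) : ℂ) := by
  have hQ : X.Q (X.componentSub Y c) = ∏ v with comp Y hY v = c,
      1 / Real.sqrt ((X.degree v : ℝ) * (X.degree (σ v) : ℝ)) := by
    rw [Q_componentSub hY]
    have : ∀ v, 1 / Real.sqrt ((X.degree v : ℝ) * (X.degree (σ v) : ℝ)) =
        1 / Real.sqrt (X.degree v) * (1 / Real.sqrt (X.degree (σ v))) := fun v => by
      rw [Real.sqrt_mul (Nat.cast_nonneg _), one_div_mul_one_div]
    simp only [this]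
    rw [Finset.prod_mul_distrib,
      h.prod_comp_apply hY c (fun v => 1 / Real.sqrt (X.degree v : ℝ)), ← Finset.prod_mul_distrib]
    refine Finset.prod_congr rfl fun v _ => ?_
    rw [one_div_mul_one_div, Real.mul_self_sqrt (Nat.cast_nonneg _)]
  rw [hQ, Complex.ofReal_prod, ← Finset.prod_mul_distrib]
  refine Finset.prod_congr rfl fun v _ => ?_
  simp [randic, div_eq_mul_inv]

open Classical in
lemma Compat.prod_randic_symm [Fintype V] {σ : Equiv.Perm V} {Y : X.Sub} (h : Compat σ Y)
    (hY : Y.IsSpanning) (c : Y.coe.ConnectedComponent) :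
    ∏ v with comp Y hY v = c, X.randic v (σ.symm v) =
      (starRingEnd ℂ) (∏ v with comp Y hY v = c, X.randic v (σ v)) := by
  rw [map_prod, ← h.prod_comp_apply hY c]
  refine Finset.prod_congr rfl fun v _ => ?_
  rw [randic_conj, Equiv.symm_apply_apply]

/-! ### Cycle values and cycle counts -/

open Classical in
lemma Compat.walkValue_eq [Fintype V] {σ : Equiv.Perm V} {Y : X.Sub} (h : Compat σ Y)
    (hY : Y.IsSpanning) {c : Y.coe.ConnectedComponent} {u : V} {w : X.underlying.Walk u u}
    (hw : X.Traverses (X.componentSub Y c) w) :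
    X.walkValue w = ∏ v with comp Y hY v = c, X.randic v (σ v) ∨
      X.walkValue w = (starRingEnd ℂ) (∏ v with comp Y hY v = c, X.randic v (σ v)) := by
  obtain ⟨hw, hc⟩ := hw
  have hsupp : ∀ v, v ∈ w.support ↔ comp Y hY v = c := fun v => by
    rw [← SimpleGraph.Walk.mem_verts_toSubgraph, hc, mem_componentSub_verts hY]
  have hnf : (w.darts.map (·.fst)).Nodup := by
    rw [SimpleGraph.Walk.map_fst_darts]; exact hw.nodup_dropLast_support
  have hns : (w.darts.map (·.snd)).Nodup := by
    rw [SimpleGraph.Walk.map_snd_darts]; exact hw.support_nodup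
  have hf : (w.darts.map (·.fst)).toFinset = Finset.univ.filter fun v => comp Y hY v = c := by
    ext v
    rw [List.mem_toFinset, Finset.mem_filter, ← hsupp, ← SimpleGraph.Walk.map_fst_darts_append,
      List.mem_append, List.mem_singleton]
    refine ⟨fun h => ⟨Finset.mem_univ _, Or.inl h⟩, ?_⟩
    rintro ⟨-, h | rfl⟩
    · exact h
    · exact List.mem_map.2 ⟨w.firstDart hw.not_nil, w.firstDart_mem_darts _, rfl⟩
  have hs : (w.darts.map (·.snd)).toFinset = Finset.univ.filter fun v => comp Y hY v = c := by
    ext v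
    rw [List.mem_toFinset, Finset.mem_filter, ← hsupp, ← SimpleGraph.Walk.cons_map_snd_darts,
      List.mem_cons]
    refine ⟨fun h => ⟨Finset.mem_univ _, Or.inr h⟩, ?_⟩
    rintro ⟨-, rfl | h⟩
    · exact List.mem_map.2 ⟨w.lastDart hw.not_nil, w.lastDart_mem_darts _, rfl⟩
    · exact h
  rcases h.walk_directed hw (hc ▸ componentSub_le hY c) with hd | hd
  · left
    rw [← hf, List.prod_toFinset _ hnf, List.map_map, walkValue]
    congr 1
    refine List.map_congr_left fun d hd' => ?_
    simp [hd d hd']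
  · right
    -- Against `σ`, index each dart by its head `v`: its entry is the conjugate of the one at `(v, σ
    -- v)`.
    rw [map_prod, ← hs, List.prod_toFinset _ hns, List.map_map, walkValue]
    congr 1
    refine List.map_congr_left fun d hd' => ?_
    simp [hd d hd', randic_conj]

open Classical in
-- All traversals have the same value up to conjugation, so a conjugation-invariant property can be
-- tested on the product along `σ`.
lemma Compat.exists_traverses_iff [Fintype V] {σ : Equiv.Perm V} {Y : X.Sub} (h : Compat σ Y)
    (hY : Y.IsSpanning) (c : Y.coe.ConnectedComponent) (P : ℂ → Prop)
    (hP : ∀ z, P z ↔ P ((starRingEnd ℂ) z)) :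
    (∃ (u : V) (w : X.underlying.Walk u u), X.Traverses (X.componentSub Y c) w ∧
      P (X.walkValue w)) ↔ X.IsCycleSub (X.componentSub Y c) ∧
      P (∏ v with comp Y hY v = c, X.randic v (σ v)) := by
  have key : ∀ (u : V) (w : X.underlying.Walk u u), X.Traverses (X.componentSub Y c) w →
      (P (X.walkValue w) ↔ P (∏ v with comp Y hY v = c, X.randic v (σ v))) := by
    intro u w hw
    rcases h.walkValue_eq hY hw with h1 | h1
    · rw [h1]
    · rw [h1, ← hP]
  constructor
  · rintro ⟨u, w, hw, hp⟩
    exact ⟨⟨u, w, hw⟩, (key u w hw).1 hp⟩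
  · rintro ⟨⟨u, w, hw⟩, hp⟩
    exact ⟨u, w, hw, (key u w hw).2 hp⟩

lemma conj_eq_ofReal_iff (z : ℂ) (r : ℝ) : (starRingEnd ℂ) z = (r : ℂ) ↔ z = (r : ℂ) := by
  rw [← Complex.conj_ofReal r, (starRingEnd ℂ).injective.eq_iff, Complex.conj_ofReal]

open Classical in
-- Every cycle inside `Y` is a full component, so cycle counts become sums of indicators and the
-- weight factors.
lemma ncard_cycles_le [Fintype V] {σ : Equiv.Perm V} {Y : X.Sub} (h : Compat σ Y)
    (hY : Y.IsSpanning) (P : X.Sub → Prop) (hP : ∀ C, P C → X.IsCycleSub C) :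
    {C : X.Sub | C ≤ Y ∧ P C}.ncard =
      ∑ c : Y.coe.ConnectedComponent, if P (X.componentSub Y c) then 1 else 0 := by
  have : {C : X.Sub | C ≤ Y ∧ P C} =
      X.componentSub Y '' ((Finset.univ.filter fun c => P (X.componentSub Y c) :
        Finset Y.coe.ConnectedComponent) : Set Y.coe.ConnectedComponent) := by
    ext C
    simp only [Set.mem_ofPred_eq, Set.mem_image, Finset.coe_filter, Finset.mem_univ, true_and]
    constructor
    · rintro ⟨hle, hC⟩
      obtain ⟨u, w, hw, rfl⟩ := hP C hC
      have := cycle_eq_componentSub hY h.neighborSet_small hw hle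
      exact ⟨_, this ▸ hC, this.symm⟩
    · rintro ⟨c, hc, rfl⟩
      exact ⟨componentSub_le hY c, hc⟩
  rw [this, Set.ncard_image_of_injective _ (componentSub_injective hY), Set.ncard_coe_finset,
    Finset.card_filter]

/-! ### Assembling the formula -/

open Classical in
lemma Compat.component_factor [Fintype V] {σ : Equiv.Perm V} {Y : X.Sub} (h : Compat σ Y)
    (hY : Y.IsSpanning) (c : Y.coe.ConnectedComponent) :
    (∏ v with comp Y hY v = c, X.randic v (σ v)) +
        (if X.IsCycleSub (X.componentSub Y c) then
          ∏ v with comp Y hY v = c, X.randic v (σ.symm v) else 0) =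
      (-1) ^ ((if X.IsNegativeCycle (X.componentSub Y c) then 1 else 0) +
        (if X.IsSemiNegativeCycle (X.componentSub Y c) then 1 else 0)) *
      2 ^ ((if X.IsNegativeCycle (X.componentSub Y c) then 1 else 0) +
        (if X.IsPositiveCycle (X.componentSub Y c) then 1 else 0)) *
      (X.Q (X.componentSub Y c) : ℂ) := by
  have hp : X.IsPositiveCycle (X.componentSub Y c) ↔ _ :=
    h.exists_traverses_iff hY c (fun z => ∃ r : ℝ, 0 < r ∧ z = (r : ℂ)) fun z => by
      simp only [conj_eq_ofReal_iff]
  have hn : X.IsNegativeCycle (X.componentSub Y c) ↔ _ :=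
    h.exists_traverses_iff hY c (fun z => ∃ r : ℝ, r < 0 ∧ z = (r : ℂ)) fun z => by
      simp only [conj_eq_ofReal_iff]
  have hs : X.IsSemiNegativeCycle (X.componentSub Y c) ↔ _ :=
    h.exists_traverses_iff hY c (fun z => z = -omega * (X.Q (X.componentSub Y c) : ℂ) ∨
      z = -(starRingEnd ℂ) omega * (X.Q (X.componentSub Y c) : ℂ)) fun z => by
      rw [← (starRingEnd ℂ).injective.eq_iff (a := z),
        ← (starRingEnd ℂ).injective.eq_iff (a := z)]
      simp only [map_mul, map_neg, Complex.conj_conj, Complex.conj_ofReal]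
      exact or_comm
  rw [hp, hn, hs]
  by_cases hc : X.IsCycleSub (X.componentSub Y c)
  · simp only [hc, if_true, true_and]
    rw [h.prod_randic_symm hY, h.prod_randic hY]
    refine add_conj_eq ?_ (Q_componentSub_pos h hY c)
    rw [← Finset.prod_pow]
    exact Finset.prod_eq_one fun v _ => hermitianAdj_pow_six (Y.adj_sub (h.adj v))
  -- On an edge all exponents vanish, and the two conjugate unimodular entries multiply to `1`.
  · simp only [hc, if_false, false_and, add_zero, pow_zero, one_mul]
    obtain ⟨v, rfl⟩ := comp_surjective hY c
    rw [h.isCycleSub_iff hY, not_not, Equiv.eq_symm_apply] at hc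
    have hset : (Finset.univ.filter fun x => comp Y hY x = comp Y hY v) = {v, σ v} := by
      ext x
      rw [Finset.mem_filter, ← mem_componentSub_verts hY, h.componentSub_eq_edge hY hc]
      simp
    have hadj := Y.adj_sub (h.adj v)
    rw [h.prod_randic hY, hset, Finset.prod_pair hadj.ne, hc, hermitianAdj_mul_symm hadj, one_mul]

open Classical in
lemma Compat.sum_compat [Fintype V] {σ : Equiv.Perm V} {Y : X.Sub} (h : Compat σ Y)
    (hY : Y.IsSpanning) :
    ∑ τ : Equiv.Perm V with Compat τ Y, ((Equiv.Perm.sign τ : ℤ) : ℂ) * ∏ v, X.randic v (τ v) =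
      (-1 : ℂ) ^ (X.rank Y + X.ln Y + X.lsn Y) * 2 ^ (X.ln Y + X.lp Y) * (X.Q Y : ℂ) := by
  have hsign : ∀ τ ∈ (Finset.univ.filter fun τ : Equiv.Perm V => Compat τ Y),
      ((Equiv.Perm.sign τ : ℤ) : ℂ) * ∏ v, X.randic v (τ v) =
        (-1) ^ X.rank Y * ∏ v, X.randic v (τ v) := fun τ hτ => by
    rw [((Finset.mem_filter.1 hτ).2 : Compat τ Y).sign_eq hY]
  rw [Finset.sum_congr rfl hsign, ← Finset.mul_sum, h.sum_prod hY fun u v => X.randic u v,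
    Finset.prod_congr rfl fun c _ => h.component_factor hY c, Finset.prod_mul_distrib,
    Finset.prod_mul_distrib, Finset.prod_pow_eq_pow_sum, Finset.prod_pow_eq_pow_sum,
    Finset.sum_add_distrib, Finset.sum_add_distrib, ← Complex.ofReal_prod, ← Q_eq_prod hY, ln, lsn,
    lp, ncard_cycles_le h hY _ fun C ⟨u, w, hw, _⟩ => ⟨u, w, hw⟩,
    ncard_cycles_le h hY _ fun C ⟨u, w, hw, _⟩ => ⟨u, w, hw⟩,
    ncard_cycles_le h hY _ fun C ⟨u, w, hw, _⟩ => ⟨u, w, hw⟩, add_assoc, pow_add _ (X.rank Y)]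
  ring

end MixedGraph

open Classical in
theorem theorem4p1 {V : Type*} [Fintype V] (X : MixedGraph V) :
    X.randic.det =
      ∑ Y : X.Sub with Y.IsSpanning ∧ X.IsElementary Y,
        (-1 : ℂ) ^ (X.rank Y + X.ln Y + X.lsn Y) * 2 ^ (X.ln Y + X.lp Y) * (X.Q Y : ℂ) := by
  have hsum : ∀ Y ∈ (Finset.univ.filter fun Y : X.Sub => Y.IsSpanning ∧ X.IsElementary Y),
      (-1 : ℂ) ^ (X.rank Y + X.ln Y + X.lsn Y) * 2 ^ (X.ln Y + X.lp Y) * (X.Q Y : ℂ) =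
      ∑ τ : Equiv.Perm V with MixedGraph.Compat τ Y,
        ((Equiv.Perm.sign τ : ℤ) : ℂ) * ∏ v, X.randic v (τ v) := fun Y hY => by
    obtain ⟨hY, he⟩ := (Finset.mem_filter.1 hY).2
    obtain ⟨σ, hσ⟩ := MixedGraph.exists_compat hY he
    exact (hσ.sum_compat hY).symm
  -- `Matrix.det_apply'` uses the entries at `(τ v, v)`; transposing turns them into `(v, τ v)`.
  rw [Finset.sum_congr rfl hsum, ← Matrix.det_transpose, Matrix.det_apply']
  simp only [Matrix.transpose_apply]
  rw [← Finset.sum_filter_of_ne (p := fun τ : Equiv.Perm V => ∀ v, X.underlying.Adj v (τ v))]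
  · rw [← Finset.sum_fiberwise_of_maps_to (g := X.permSub)
      (t := Finset.univ.filter fun Y : X.Sub => Y.IsSpanning ∧ X.IsElementary Y)]
    -- Among the surviving permutations, the fibre of `permSub` over `Y` is exactly `Compat τ Y`.
    · refine Finset.sum_congr rfl fun Y hY => Finset.sum_congr ?_ fun _ _ => rfl
      have hY := (Finset.mem_filter.1 hY).2.1
      ext τ
      simp only [Finset.mem_filter, Finset.mem_univ, true_and]
      constructor
      · rintro ⟨h, rfl⟩
        exact MixedGraph.compat_permSub h
      · exact fun h => ⟨fun v => Y.adj_sub (h.adj v), h.eq_permSub hY⟩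
    · intro τ hτ
      have hτ := MixedGraph.compat_permSub (Finset.mem_filter.1 hτ).2
      exact Finset.mem_filter.2 ⟨Finset.mem_univ _, MixedGraph.permSub_isSpanning τ,
        hτ.isElementary (MixedGraph.permSub_isSpanning τ)⟩
  · intro τ _ hne v
    by_contra hv
    exact hne (mul_eq_zero_of_right _
      (Finset.prod_eq_zero (Finset.mem_univ v) (MixedGraph.randic_eq_zero hv)))
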